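/- Let $k$ be an algebraically closed field, $p=\operatorname{char}k$ if $\operatorname{char}k>0$ and $p=1$ if $\operatorname{char}k=0$. Let $A$ be the complete local ring at a closed point $P$ of a nonsingular threefold over $k$, with maximal ideal $\mathfrak m$. Let $\mathcal R=\bigoplus_{n\ge 0}(I_n,n)$ be an idealistic filtration of i.f.g. type on $A$, i.e. a finitely generated graded $A$-algebra with ideals $A=I_0\supseteq I_1\supseteq I_2\supseteq\cdots$, $I_1\ne 0$; "$(f,n)\in\mathcal R$" means $f\in I_n$. Its support is $$\mathrm{Supp}(\mathcal R)_P=\{Q\in\operatorname{Spec}A\mid \operatorname{ord}_Q(I_n)\ge n\ \text{for all } n\ge 0\},$$ and we assume $P\in\mathrm{Supp}(\mathcal R)_P$. Let $E$ be a set of divisors through $P$ (the components of the young part of the boundary). A *presentation* of $(\mathcal R,E)$ consists of a regular system of parameters $(x,y,z)$ of $A$ (so $A=k[[x,y,z]]$), an element $h$ and a monomial $x^\alpha y^\beta$ of level $a>0$ such that the following hold. 1. $h=z^{p^e}+a_1z^{p^e-1}+\cdots+a_{p^e}$ with $a_i\in k[[x,y]]$ and $\operatorname{ord}_P(a_i)>i$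 for $1\le i\le p^e$; $(h,p^e)\in\mathcal R$; and $\{(h,p^e)\}$ is a leading generator system with $\tau=1$: the leading algebra $\bigoplus_n\{f \bmod \mathfrak m^{n+1}\mid (f,n)\in\mathcal D\mathcal R,\ f\in\mathfrak m^n\}$ of the differential saturation $\mathcal D\mathcal R$ (generated by all $(\delta f,\max\{n-\deg\delta,0\})$ with $(f,n)\in\mathcal R$ and $\delta$ a differential operator over $k$) is $k[z^{p^e}]$. 2. Every component in $E$ is one of $H_x=\{x=0\}$, $H_y=\{y=0\}$; if $\alpha\neq0$ then $H_x\in E$; if $\beta\ne0$ then $H_y\in E$; and $(x^\alpha y^\beta,a)\in\mathcal R$. 3. If $(f,\lambda)\in\mathcal R$, then $(\partial_z^{(n)}f,\max\{\lambda-n,0\})\in\mathcal R$ for every divided (Hasse) derivative $\partial_z^{(n)}=\frac1{n!}\frac{\partial^n}{\partial z^n}$, $n\ge0$. 4. If $(f,\lambda)\in\mathcal R$ and $f=\sum_{b\ge0}c_bh^b$ with each $c_b\in k[[x,y]][z]$ of degree less than $p^e$ in $z$, then $x^{\lceil\lambda\alpha/a\rceil}y^{\lceil\lambda\beta/a\rceil}$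 divides $c_0$. Write $\xi_{H_x},\xi_{H_y}$ for the generic points of $H_x,H_y$, and put $\mu(P)=(\alpha+\beta)/a$, $\mu(\xi_{H_x})=\alpha/a$, $\mu(\xi_{H_y})=\beta/a$. For $*=P,\xi_{H_x},\xi_{H_y}$ let $\mathrm{Slope}(*)=\min\{\operatorname{ord}_*(a_{p^e})/p^e,\ \mu(*)\}$. The presentation is *well-adapted at* $*$ if $\mathrm{Slope}(*)=\mu(*)$, or $\mathrm{Slope}(*)=\operatorname{ord}_*(a_{p^e})/p^e<\mu(*)$ and the initial form of $a_{p^e}$ at $*$ is not a $p^e$-th power. (At $P$ the initial form is the lowest-degree homogeneous part; at $\xi_{H_x}$ it is $x^rg(y)$ where $a_{p^e}=x^r(g(y)+x\,\omega(x,y))$, $g\neq 0$; similarly at $\xi_{H_y}$.) The invariant $\mathrm H(\xi_D)$ of a divisor $D$ is the slope at $\xi_D$ of any presentation in which $D$ is one of the divisors $H_x,H_y$ and which is well-adapted at $\xi_D$. **Proposition 6.** Suppose given a presentation of $(\mathcal R,E)$, with parameters $(x,y,z)$, that is well-adapted simultaneously at $P$, $\xi_{H_x}$ and $\xi_{H_y}$,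 and let $h_x=\mathrm H(\xi_{H_x})$, $h_y=\mathrm H(\xi_{H_y})$ (each computed from any presentation as above). Then $$\mathrm{Supp}(\mathcal R)_P=\begin{cases}V(z,x)\cup V(z,y)&\text{if }h_x\ge1\text{ and }h_y\ge1,\\ V(z,x)&\text{if }h_x\ge1\text{ and }h_y<1,\\ V(z,y)&\text{if }h_x<1\text{ and }h_y\ge1,\\ V(z,x,y)=\{P\}&\text{if }h_x<1\text{ and }h_y<1.\end{cases}$$ -/

import Mathlib

open scoped ENNReal

noncomputable section

/-- The ring `k[[x, y]]`, with `x = X 0` and `y = X 1`. -/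
abbrev Base (k : Type*) [Field k] : Type _ := MvPowerSeries (Fin 2) k

/-- The ring `k[[x, y, z]] = k[[x, y]][[z]]`. -/
abbrev Model (k : Type*) [Field k] : Type _ := PowerSeries (Base k)

/-- The divided (Hasse) derivative `(1 / n!) ∂ⁿ / ∂zⁿ` on `k[[x, y]][[z]]`. -/
def hasseZ {k : Type*} [Field k] (n : ℕ) (f : Model k) : Model k :=
  PowerSeries.mk fun j => ((j + n).choose n : Base k) * PowerSeries.coeff (j + n) f

/-- A `k`-linear differential operator on `A` of order at most `n`
(Grothendieck's inductive definition by commutators with multiplications). -/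
def IsDiffOp {k A : Type*} [Field k] [CommRing A] [Algebra k A] : ℕ → (A →ₗ[k] A) → Prop
  | 0, D => ∀ a f : A, D (a * f) = a * D f
  | n + 1, D => ∀ a : A,
      IsDiffOp n (D ∘ₗ LinearMap.mulLeft k a - LinearMap.mulLeft k a ∘ₗ D)

/-- An idealistic filtration of i.f.g. type `⊕ₙ (Iₙ, n)` on `A`: a finitely generated graded
`A`-algebra with `A = I₀ ⊇ I₁ ⊇ I₂ ⊇ ⋯` and `I₁ ≠ 0`. -/
structure IdealisticFiltration (A : Type*) [CommRing A] where
  /-- The ideal at level `n`. -/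
  level : ℕ → Ideal A
  level_zero : level 0 = ⊤
  level_succ_le : ∀ n, level (n + 1) ≤ level n
  level_mul_le : ∀ m n, level m * level n ≤ level (m + n)
  level_one_ne_bot : level 1 ≠ ⊥
  /-- The algebra `⊕ₙ Iₙ Tⁿ`, as a subalgebra of `A[T]`, is finitely generated. -/
  finitelyGenerated :
    (Algebra.adjoin A
      {F : Polynomial A | ∃ n, ∃ f ∈ level n, F = Polynomial.monomial n f}).FG

namespace IdealisticFiltration

variable {A : Type*} [CommRing A]

/-- The support (singular locus): the points `Q` of `Spec A` with `ord_Q (Iₙ) ≥ n` for all `n`. -/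
def support (R : IdealisticFiltration A) : Set (PrimeSpectrum A) :=
  {Q | ∀ n, (R.level n).map (algebraMap A (Localization.AtPrime Q.asIdeal)) ≤
    IsLocalRing.maximalIdeal (Localization.AtPrime Q.asIdeal) ^ n}

/-- The level `n` ideal of the differential saturation: it is generated by the `δ f` with
`f` of level `a`, with `δ` a differential operator of degree at most `d`, and `n ≤ max (a - d, 0)`. -/
def diffSat (k : Type*) [Field k] [Algebra k A] (R : IdealisticFiltration A) (n : ℕ) : Ideal A :=
  Ideal.span {g | ∃ (a d : ℕ) (f : A) (δ : A →ₗ[k] A),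
    f ∈ R.level a ∧ IsDiffOp d δ ∧ n ≤ a - d ∧ g = δ f}

/-- The elements of `𝔪ⁿ` whose class in `𝔪ⁿ / 𝔪ⁿ⁺¹` lies in the degree `n` part of the leading
algebra of the differential saturation. -/
def leading (k : Type*) [Field k] [Algebra k A] [IsLocalRing A] (R : IdealisticFiltration A)
    (n : ℕ) : Set A :=
  {f | f ∈ IsLocalRing.maximalIdeal A ^ n ∧ ∃ g ∈ R.diffSat k n,
    g ∈ IsLocalRing.maximalIdeal A ^ n ∧ f - g ∈ IsLocalRing.maximalIdeal A ^ (n + 1)}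

end IdealisticFiltration

/-- The data of a regular system of parameters `(x, y, z)`, of a Weierstrass polynomial
`h = z^(p^e) + a₁ z^(p^e - 1) + ⋯ + a_(p^e)` and of a monomial `x^α y^β` at level `a`. -/
structure MonomialData (k A : Type*) [Field k] [CommRing A] [Algebra k A] where
  /-- The identification of `A` with `k[[x, y, z]]` given by the regular system of parameters. -/
  coord : Model k ≃ₐ[k] A
  /-- The exponent `e`. -/
  e : ℕ
  /-- The coefficients `aᵢ`, for `1 ≤ i ≤ p^e`. -/
  coeff : ℕ → Base k
  /-- The exponents `α = expo 0` and `β = expo 1`. -/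
  expo : Fin 2 → ℕ
  /-- The level `a` of the monomial. -/
  lev : ℕ

namespace MonomialData

variable {k A : Type*} [Field k] [CommRing A] [Algebra k A]

/-- The inclusion of `k[[x, y]]` in `A` given by the parameters. -/
def ofBase (S : MonomialData k A) (c : Base k) : A := S.coord (PowerSeries.C c)

/-- The parameters `x = par 0` and `y = par 1`. -/
def par (S : MonomialData k A) (i : Fin 2) : A := S.ofBase (MvPowerSeries.X i)

/-- The parameter `z`. -/
def z (S : MonomialData k A) : A := S.coord PowerSeries.X

/-- The ideal of `H_x = {x = 0}` (for `i = 0`) or of `H_y = {y = 0}` (for `i = 1`). -/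
def divisor (S : MonomialData k A) (i : Fin 2) : Ideal A := Ideal.span {S.par i}

/-- The element `h = z^(p^e) + a₁ z^(p^e - 1) + ⋯ + a_(p^e)`. -/
def h (p : ℕ) (S : MonomialData k A) : A :=
  S.z ^ p ^ S.e + ∑ i ∈ Finset.Icc 1 (p ^ S.e), S.ofBase (S.coeff i) * S.z ^ (p ^ S.e - i)

/-- The polynomial `∑ c j * z ^ j`, over `j < p^e`, with coefficients in `k[[x, y]]`. -/
def poly (p : ℕ) (S : MonomialData k A) (c : ℕ → Base k) : A :=
  ∑ j ∈ Finset.range (p ^ S.e), S.ofBase (c j) * S.z ^ j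

/-- `f = ∑_b c_b h^b` is the power series expansion of `f` with respect to `h` and `(x, y, z)`,
where `c_b = ∑ c b j * z ^ j`, over `j < p^e`, has degree less than `p^e` in `z`. -/
def IsExpansion (p : ℕ) (S : MonomialData k A) (f : A) (c : ℕ → ℕ → Base k) : Prop :=
  ∀ N, S.h p ^ N ∣ f - ∑ b ∈ Finset.range N, S.poly p (c b) * S.h p ^ b

/-- The monomial case with `τ = 1`, for the filtration `R` and the set `E` of (the ideals of) the
components through the closed point of the young part of the boundary, with respect to the
parameters `(x, y, z)`, the leading generator system `{(h, p^e)}` and the monomial `x^α y^β`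
at level `a`. -/
structure IsSituation [IsLocalRing A] (p : ℕ) (S : MonomialData k A)
    (R : IdealisticFiltration A) (E : Set (Ideal A)) : Prop where
  h_mem : S.h p ∈ R.level (p ^ S.e)
  lt_order : ∀ i ∈ Finset.Icc 1 (p ^ S.e), (i : ℕ∞) < (S.coeff i).order
  /-- The leading algebra of the differential saturation is `k[z^(p^e)]`. -/
  leading_eq : ∀ n, R.leading k n =
    {f | ∃ c : k, (p ^ S.e ∣ n ∨ c = 0) ∧
      f - algebraMap k A c * S.z ^ n ∈ IsLocalRing.maximalIdeal A ^ (n + 1)} ∩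
        (IsLocalRing.maximalIdeal A ^ n : Ideal A)
  boundary_subset : E ⊆ Set.range S.divisor
  divisor_mem : ∀ i, S.expo i ≠ 0 → S.divisor i ∈ E
  lev_pos : 0 < S.lev
  monomial_mem : ∏ i, S.par i ^ S.expo i ∈ R.level S.lev
  /-- `R` is saturated for the divided derivatives in `z`. -/
  hasse_mem : ∀ n l, ∀ f ∈ R.level l, S.coord (hasseZ n (S.coord.symm f)) ∈ R.level (l - n)
  /-- The power `(x^α y^β)^(l/a)` divides the constant term of the expansion of every `f` of
  level `l`. -/
  monomial_dvd : ∀ l, ∀ f ∈ R.level l, ∀ c, S.IsExpansion p f c →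
    ∏ i, S.par i ^ ⌈((l * S.expo i : ℕ) : ℚ) / S.lev⌉₊ ∣ S.poly p (c 0)

/-- The weights on `(x, y)` for which the weighted order of an element of `k[[x, y]]` is its order
at the closed point `P`. -/
def atP : Fin 2 → ℕ := fun _ => 1

/-- The weights on `(x, y)` for which the weighted order of an element of `k[[x, y]]` is its order
along `{x = 0}` (for `i = 0`) or along `{y = 0}` (for `i = 1`). -/
def atDiv (i : Fin 2) : Fin 2 → ℕ := Pi.single i 1

/-- `μ` at `P`, `ξ_{H_x}` or `ξ_{H_y}`: the order of `x^α y^β` there, divided by `a`. -/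
def mu (S : MonomialData k A) (w : Fin 2 → ℕ) : ℝ≥0∞ :=
  ((∑ i, w i * S.expo i : ℕ) : ℝ≥0∞) / (S.lev : ℝ≥0∞)

/-- The order of the last coefficient `a_(p^e)` at `P`, `ξ_{H_x}` or `ξ_{H_y}`, divided
by `p^e`. -/
def lastOrd (p : ℕ) (S : MonomialData k A) (w : Fin 2 → ℕ) : ℝ≥0∞ :=
  ((S.coeff (p ^ S.e)).weightedOrder w : ℝ≥0∞) / ((p ^ S.e : ℕ) : ℝ≥0∞)

/-- The slope of `h` at `P`, `ξ_{H_x}` or `ξ_{H_y}` with respect to `(x, y, z)`. -/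
def slope (p : ℕ) (S : MonomialData k A) (w : Fin 2 → ℕ) : ℝ≥0∞ :=
  min (S.lastOrd p w) (S.mu w)

/-- The initial form of the last coefficient `a_(p^e)` at `P`, `ξ_{H_x}` or `ξ_{H_y}`. -/
def initialForm (p : ℕ) (S : MonomialData k A) (w : Fin 2 → ℕ) : Base k :=
  MvPowerSeries.weightedHomogeneousComponent w
    ((S.coeff (p ^ S.e)).weightedOrder w).toNat (S.coeff (p ^ S.e))

/-- `h` is well-adapted at `P`, `ξ_{H_x}` or `ξ_{H_y}` with respect to `(x, y, z)`. -/
def WellAdapted (p : ℕ) (S : MonomialData k A) (w : Fin 2 → ℕ) : Prop :=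
  S.slope p w = S.mu w ∨
    (S.slope p w = S.lastOrd p w ∧ S.lastOrd p w < S.mu w ∧
      ¬ ∃ u : Base k, u ^ p ^ S.e = S.initialForm p w)

end MonomialData

/-- `v` is a value of the invariant `H` at the generic point of the divisor with ideal `D`: it is
the slope there of some `h`, well-adapted there with respect to some `(x, y, z)`. -/
def IsInvariantH (k : Type*) {A : Type*} [Field k] [CommRing A] [Algebra k A] [IsLocalRing A]
    (p : ℕ) (R : IdealisticFiltration A) (E : Set (Ideal A)) (D : Ideal A) (v : ℝ≥0∞) : Prop :=
  ∃ (S : MonomialData k A) (i : Fin 2), S.IsSituation p R E ∧ S.divisor i = D ∧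
    S.WellAdapted p (MonomialData.atDiv i) ∧ v = S.slope p (MonomialData.atDiv i)

end

/-! Write `q = p^e` and `x_i` for either of `x`, `y`. Everything reduces to one equivalence for a
presentation well-adapted along `x_i = 0`: the slope there is at least one if and only if the
support has a point of that divisor other than `P`, and such a point can only be the generic point
of `z = x_i = 0`. The right-hand side does not mention the presentation, so the test `H ≥ 1` may be
made on the given one. Slope at least one gives the curve (`mem_adicIdeal_of_hasse_stable`). The
exponent of `x_i` is then at least `a`, so remainders modulo `h` of elements of level `l` are
divisible by `x_i^l`. Applied to divided derivatives of `h`, this gives `x_i^j ∣ a_j` for `j < q`;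
the slope gives it for `j = q`. If some `f` of level `l` had order `r < l` along `(x_i, z)`, a
suitable divided derivative of order `b * q` would bring an extremal coefficient of `f` into degree
below `q`, where division by `h` shows that it is too divisible. Conversely, let `Q ≠ P` be in the
support. It contains the monomial, hence an `x_i` with positive exponent, and not the other
parameter. Modulo `x_i` the middle coefficients of `h` vanish, leaving `z^q + a_q`. A Taylor
expansion in the other parameter shows that order `q` along `Q` kills the divided derivatives of
order `1, …, q - 1` of the restriction of `a_q` (`hasse_eq_zero_of_mul_mem_pow`), which is therefore
a `q`-th power. Well-adaptedness then forces `x_i ∣ a_q`, so `z ∈ Q` and `Q = (x_i, z)`. The orders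
of `h` and of the monomial along this curve give slope at least one. -/

section

open Finset

namespace PowerSeries

/-! ### Coefficients of monic polynomials in the last variable. -/

section Weierstrass

variable {B : Type*} [CommRing B]

/-- The monic polynomial `X ^ q + a 1 * X ^ (q - 1) + ⋯ + a q`. -/
noncomputable def monicPoly (q : ℕ) (a : ℕ → B) : B⟦X⟧ :=
  X ^ q + ∑ i ∈ Icc 1 q, C (a i) * X ^ (q - i)

/-- The polynomial `∑ c j * X ^ j`, over `j < q`. -/
noncomputable def lowPoly (q : ℕ) (c : ℕ → B) : B⟦X⟧ := ∑ j ∈ range q, C (c j) * X ^ j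

theorem coeff_lowPoly (q : ℕ) (c : ℕ → B) (n : ℕ) :
    coeff n (lowPoly q c) = if n < q then c n else 0 := by
  simp [lowPoly, coeff_X_pow]

theorem coeff_monicPoly (q : ℕ) (a : ℕ → B) (n : ℕ) :
    coeff n (monicPoly q a) = if n = q then 1 else if n < q then a (q - n) else 0 := by
  rw [monicPoly, map_add, coeff_X_pow, map_sum]
  simp only [coeff_C_mul, coeff_X_pow, mul_ite, mul_one, mul_zero]
  by_cases hn : n < q
  · rw [if_neg hn.ne, zero_add, if_neg hn.ne, if_pos hn, sum_eq_single (q - n)]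
    · rw [if_pos (by lia)]
    · intro i hi hne
      rw [if_neg (by have := mem_Icc.1 hi; lia)]
    · intro h
      exact absurd (mem_Icc.2 ⟨by lia, by lia⟩) h
  · rw [if_neg hn, sum_eq_zero, add_zero]
    intro i hi
    rw [if_neg (by have := mem_Icc.1 hi; lia)]

theorem coeff_monicPoly_mul (q : ℕ) (a : ℕ → B) (g : B⟦X⟧) (j : ℕ) :
    coeff (q + j) (monicPoly q a * g) =
      coeff j g + ∑ i ∈ Icc 1 q, a i * coeff (j + i) g := by
  rw [monicPoly, add_mul, map_add, coeff_X_pow_mul', if_pos (by lia), Nat.add_sub_cancel_left,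
    sum_mul, map_sum]
  congr 1
  refine sum_congr rfl fun i hi => ?_
  have := mem_Icc.1 hi
  rw [mul_assoc, coeff_C_mul, coeff_X_pow_mul', if_pos (by lia)]
  congr 3
  lia

end Weierstrass

/-! ### Order along the curve `t = X = 0`. -/

section Filtration

variable {B : Type*} [CommRing B]

/-- The `n`-th power of the ideal `(t, X)` of `B⟦X⟧`, described by coefficients. -/
def adicIdeal (t : B) (n : ℕ) : Ideal B⟦X⟧ where
  carrier := {f | ∀ j, t ^ (n - j) ∣ coeff j f}
  add_mem' hf hg j := by
    rw [map_add]
    exact dvd_add (hf j) (hg j)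
  zero_mem' j := by simp
  smul_mem' c f hf j := by
    rw [smul_eq_mul, coeff_mul]
    refine dvd_sum fun u hu => ?_
    have hle : n - j ≤ n - u.2 := by
      have := mem_antidiagonal.1 hu
      lia
    exact ((pow_dvd_pow t hle).trans (hf u.2)).mul_left _

theorem mem_adicIdeal {t : B} {n : ℕ} {f : B⟦X⟧} :
    f ∈ adicIdeal t n ↔ ∀ j, t ^ (n - j) ∣ coeff j f := Iff.rfl

theorem adicIdeal_zero (t : B) : adicIdeal t 0 = ⊤ := by
  ext f
  simp [mem_adicIdeal]

theorem adicIdeal_anti (t : B) {m n : ℕ} (h : m ≤ n) : adicIdeal t n ≤ adicIdeal t m :=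
  fun _ hf j => (pow_dvd_pow t (by lia)).trans (hf j)

theorem mem_adicIdeal_one {t : B} {f : B⟦X⟧} : f ∈ adicIdeal t 1 ↔ t ∣ constantCoeff f := by
  rw [mem_adicIdeal]
  constructor
  · intro h
    simpa using h 0
  · intro h j
    rcases j with _ | j
    · simpa using h
    · simp

theorem mul_mem_adicIdeal {t : B} {m n : ℕ} {f g : B⟦X⟧} (hf : f ∈ adicIdeal t m)
    (hg : g ∈ adicIdeal t n) : f * g ∈ adicIdeal t (m + n) := by
  intro j
  rw [coeff_mul]
  refine dvd_sum fun u hu => ?_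
  have hle : m + n - j ≤ (m - u.1) + (n - u.2) := by
    have := mem_antidiagonal.1 hu
    lia
  refine (pow_dvd_pow t hle).trans ?_
  rw [pow_add]
  exact mul_dvd_mul (hf u.1) (hg u.2)

theorem adicIdeal_one_pow_le (t : B) (n : ℕ) : adicIdeal t 1 ^ n ≤ adicIdeal t n := by
  induction n with
  | zero => simp [adicIdeal_zero]
  | succ n ih =>
    rw [pow_succ, Ideal.mul_le]
    exact fun f hf g hg => mul_mem_adicIdeal (ih hf) hg

theorem X_mem_adicIdeal_one (t : B) : (X : B⟦X⟧) ∈ adicIdeal t 1 := by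
  simp [mem_adicIdeal_one]

theorem C_mem_adicIdeal_one (t : B) : C t ∈ adicIdeal t 1 := by
  simp [mem_adicIdeal_one]

theorem eq_X_pow_mul_add_lowPoly (n : ℕ) (f : B⟦X⟧) :
    f = X ^ n * (mk fun i => coeff (i + n) f) + lowPoly n fun j => coeff j f := by
  ext m
  rw [map_add, coeff_lowPoly, coeff_X_pow_mul']
  split_ifs with h1 h2 h2
  · lia
  · simp [Nat.sub_add_cancel h1]
  · simp
  · lia

theorem adicIdeal_le_pow (t : B) (n : ℕ) : adicIdeal t n ≤ adicIdeal t 1 ^ n := by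
  intro f hf
  rw [eq_X_pow_mul_add_lowPoly n f]
  refine add_mem (Ideal.mul_mem_right _ _ (Ideal.pow_mem_pow (X_mem_adicIdeal_one t) n))
    (sum_mem fun j hj => ?_)
  obtain ⟨c, hc⟩ := hf j
  have hj' : j < n := by simpa using hj
  have hmono : C (coeff j f) * X ^ j = C c * (C t ^ (n - j) * X ^ j) := by
    rw [hc]
    simp only [map_mul, map_pow]
    ring
  rw [hmono]
  refine Ideal.mul_mem_left _ _ ?_
  have hn : n = (n - j) + j := by lia
  have hmul : adicIdeal t 1 ^ n = adicIdeal t 1 ^ (n - j) * adicIdeal t 1 ^ j := by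
    rw [← pow_add, ← hn]
  rw [hmul]
  exact Ideal.mul_mem_mul (Ideal.pow_mem_pow (C_mem_adicIdeal_one t) _)
    (Ideal.pow_mem_pow (X_mem_adicIdeal_one t) _)

theorem adicIdeal_one_le {t : B} {I : Ideal B⟦X⟧} (hX : X ∈ I) (ht : C t ∈ I) :
    adicIdeal t 1 ≤ I := by
  intro f hf
  obtain ⟨c, hc⟩ := mem_adicIdeal_one.1 hf
  rw [eq_X_mul_shift_add_const f, hc, map_mul]
  exact add_mem (Ideal.mul_mem_right _ _ hX) (Ideal.mul_mem_right _ _ ht)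

theorem isPrime_adicIdeal_one {t : B} (ht : Prime t) : (adicIdeal t 1).IsPrime := by
  have h : adicIdeal t 1 = (Ideal.span {t}).comap (constantCoeff (R := B)) := by
    ext f
    rw [mem_adicIdeal_one, Ideal.mem_comap, Ideal.mem_span_singleton]
  rw [h]
  have := (Ideal.span_singleton_prime ht.ne_zero).2 ht
  exact Ideal.comap_isPrime _ _

/-- Symbolic and ordinary powers of `(t, X)` coincide, so the order in the localization can be read
off coefficients. In degree `j` the product is `s₀ f_j` plus terms with earlier coefficients of `f`,
which are even more divisible, and `t` does not divide `s₀`. -/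
theorem mem_adicIdeal_of_mul_mem [IsDomain B] {t : B} (ht : Prime t) {n : ℕ} {s f : B⟦X⟧}
    (hs : s ∉ adicIdeal t 1) (h : s * f ∈ adicIdeal t n) : f ∈ adicIdeal t n := by
  intro j
  induction j using Nat.strong_induction_on with
  | _ j ih =>
    have hj := h j
    rw [coeff_mul, ← add_sum_erase _ _ (show (0, j) ∈ antidiagonal j by simp)] at hj
    have hrest : t ^ (n - j) ∣ ∑ u ∈ (antidiagonal j).erase (0, j), coeff u.1 s * coeff u.2 f := by
      refine dvd_sum fun u hu => ?_
      obtain ⟨hne, hu⟩ := mem_erase.1 hu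
      have hu' := mem_antidiagonal.1 hu
      have hlt : u.2 < j := by
        by_contra hge
        exact hne (Prod.ext (by simp; lia) (by simp; lia))
      exact ((pow_dvd_pow t (by lia)).trans (ih _ hlt)).mul_left _
    have h0 : ¬ t ∣ coeff 0 s := fun h0 => hs (mem_adicIdeal_one.2 (by simpa using h0))
    exact ht.pow_dvd_of_dvd_mul_left _ h0 ((dvd_add_left hrest).1 hj)

end Filtration

/-! ### Stability under divided derivatives and order. -/

section Hasse

variable {B : Type*} [CommRing B]

/-- The divided derivative `(1 / n!) dⁿ / dXⁿ`. -/
noncomputable def hasse (n : ℕ) (f : B⟦X⟧) : B⟦X⟧ :=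
  mk fun j => ((j + n).choose n : B) * coeff (j + n) f

theorem monicPoly_mem_adicIdeal {t : B} {q : ℕ} {a : ℕ → B}
    (ha : ∀ i ∈ Icc 1 q, t ^ i ∣ a i) : monicPoly q a ∈ adicIdeal t q := by
  intro j
  rw [coeff_monicPoly]
  split_ifs with h1 h2
  · simp [h1]
  · exact ha _ (by simp; lia)
  · simp

/-- The coefficient of degree `q + j` of the product is `g_j + ∑ a_i g_{j+i}`. Solving for `g_j` by
descending induction on `j` gives `g` order at least `n - q`; the start `j ≥ n - q` is vacuous. -/
theorem monicPoly_mul_mem_adicIdeal {t : B} {q n : ℕ} {a : ℕ → B} {g : B⟦X⟧}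
    (ha : ∀ i ∈ Icc 1 q, t ^ i ∣ a i)
    (hg : ∀ i, q ≤ i → t ^ (n - i) ∣ coeff i (monicPoly q a * g)) :
    monicPoly q a * g ∈ adicIdeal t n := by
  have key : ∀ m j, n - q ≤ m + j → t ^ (n - q - j) ∣ coeff j g := by
    intro m
    induction m with
    | zero =>
      intro j hj
      rw [Nat.sub_eq_zero_of_le (by lia), pow_zero]
      exact one_dvd _
    | succ m ih =>
      intro j hj
      have h := coeff_monicPoly_mul q a g j
      rw [eq_comm, ← eq_sub_iff_add_eq] at h
      rw [h]
      refine dvd_sub ?_ (dvd_sum fun i hi => ?_)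
      · have := hg (q + j) (by lia)
        rwa [← Nat.sub_sub] at this
      · have hi' := mem_Icc.1 hi
        refine (pow_dvd_pow t (show n - q - j ≤ i + (n - q - (j + i)) by lia)).trans ?_
        rw [pow_add]
        exact mul_dvd_mul (ha i hi) (ih _ (by lia))
  have hmem : g ∈ adicIdeal t (n - q) := fun j => key (n - q) j (by lia)
  exact adicIdeal_anti t (by lia) (mul_mem_adicIdeal (monicPoly_mem_adicIdeal ha) hmem)

/-- If a family of sets is stable under divided derivatives and the remainder of the division of an
element of level `l` by a monic polynomial is divisible by `t ^ l`, then the elements of level `l`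
have order at least `l` along `(t, X)`. -/
theorem mem_adicIdeal_of_hasse_stable {t : B} {q : ℕ} {a : ℕ → B} (hq : 0 < q)
    (hchoose : ∀ b d, d < q → ((d + b * q).choose (b * q) : B) = 1)
    (ha : ∀ i ∈ Icc 1 q, t ^ i ∣ a i) (L : ℕ → Set B⟦X⟧)
    (hasse_mem : ∀ n l, ∀ f ∈ L l, hasse n f ∈ L (l - n))
    (hdiv : ∀ l, ∀ f ∈ L l, ∃ c g, f = lowPoly q c + monicPoly q a * g ∧
      ∀ j < q, t ^ l ∣ c j)
    {l : ℕ} {f : B⟦X⟧} (hf : f ∈ L l) : f ∈ adicIdeal t l := by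
  classical
  by_contra hfl
  obtain ⟨r, hrl, hr, hr1⟩ : ∃ r < l, f ∈ adicIdeal t r ∧ f ∉ adicIdeal t (r + 1) := by
    have hex : ∃ n, f ∉ adicIdeal t n := ⟨l, hfl⟩
    have h0 : Nat.find hex ≠ 0 := by
      intro h
      have := Nat.find_spec hex
      rw [h, adicIdeal_zero] at this
      exact this trivial
    have hle := Nat.find_min' hex hfl
    refine ⟨Nat.find hex - 1, by lia, ?_, ?_⟩
    · exact not_not.1 (Nat.find_min hex (show Nat.find hex - 1 < Nat.find hex by lia))
    · rw [Nat.sub_add_cancel (by lia)]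
      exact Nat.find_spec hex
  have hP : ∃ j, j ≤ r ∧ ¬ t ^ (r + 1 - j) ∣ coeff j f := by
    rw [mem_adicIdeal, not_forall] at hr1
    obtain ⟨j, hj⟩ := hr1
    refine ⟨j, ?_, hj⟩
    by_contra hjr
    rw [Nat.sub_eq_zero_of_le (by lia), pow_zero] at hj
    exact hj (one_dvd _)
  obtain ⟨j₀, hj₀r, hj₀⟩ := hP
  -- The last coefficient witnessing that the order is only `r`; all later ones satisfy the bound
  -- for `r + 1`.
  set j := Nat.findGreatest (fun j => ¬ t ^ (r + 1 - j) ∣ coeff j f) r with hjdef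
  have hj : ¬ t ^ (r + 1 - j) ∣ coeff j f :=
    Nat.findGreatest_spec (P := fun j => ¬ t ^ (r + 1 - j) ∣ coeff j f) hj₀r hj₀
  have hjr : j ≤ r := Nat.findGreatest_le r
  have hmax : ∀ i, j < i → t ^ (r + 1 - i) ∣ coeff i f := by
    intro i hi
    by_cases hir : i ≤ r
    · exact not_not.1 (Nat.findGreatest_is_greatest
        (P := fun j => ¬ t ^ (r + 1 - j) ∣ coeff j f) hi hir)
    · rw [Nat.sub_eq_zero_of_le (by lia), pow_zero]
      exact one_dvd _
  clear_value j
  have hdecomp := Nat.mod_add_div' j q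
  have hlt := Nat.mod_lt j hq
  set b := j / q
  set d := j % q
  -- With `j = d + b * q`, the derivative of order `b * q` moves this coefficient to degree `d < q`,
  -- multiplied by a binomial coefficient equal to `1`.
  obtain ⟨c, g, hg, hc⟩ := hdiv _ _ (hasse_mem (b * q) l f hf)
  -- In degrees `i ≥ q` the remainder is invisible, and there the derivative involves only
  -- coefficients of `f` of index `i + b * q > j`.
  have hu : monicPoly q a * g ∈ adicIdeal t (r + 1 - b * q) := by
    refine monicPoly_mul_mem_adicIdeal ha fun i hi => ?_
    have h := congrArg (coeff i) hg
    rw [map_add, coeff_lowPoly, if_neg (by lia), zero_add] at h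
    rw [← h, hasse, coeff_mk, Nat.sub_sub, add_comm (b * q) i]
    exact (hmax _ (by lia)).mul_left _
  have hlow : lowPoly q c ∈ adicIdeal t (r + 1 - b * q) := by
    intro i
    rw [coeff_lowPoly]
    split_ifs with hi
    · exact (pow_dvd_pow t (by lia)).trans (hc i hi)
    · exact dvd_zero _
  have hd := (hg ▸ add_mem hlow hu : hasse (b * q) f ∈ adicIdeal t (r + 1 - b * q)) d
  rw [hasse, coeff_mk, hchoose b d hlt, one_mul, hdecomp, Nat.sub_sub, add_comm (b * q) d,
    hdecomp] at hd
  exact hj hd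

end Hasse

end PowerSeries

/-! ### Weierstrass division over a power series ring. -/

namespace MvPowerSeries

variable {σ k : Type*} [CommRing k]

theorem natCast_le_order_iff {n : ℕ} {f : MvPowerSeries σ k} :
    (n : ℕ∞) ≤ f.order ↔ ∀ m, m.degree < n → coeff m f = 0 := by
  constructor
  · intro h m hm
    exact coeff_of_lt_order (lt_of_lt_of_le (by exact_mod_cast hm) h)
  · exact fun h => nat_le_order h

/-- The linear system underlying the division by a distinguished polynomial. -/
theorem exists_solution_of_constantCoeff_eq_zero (s : Finset ℕ) (a : ℕ → MvPowerSeries σ k)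
    (ha : ∀ i ∈ s, constantCoeff (a i) = 0) (f : ℕ → MvPowerSeries σ k) :
    ∃ g : ℕ → MvPowerSeries σ k, ∀ j, g j + ∑ i ∈ s, a i * g (j + i) = f j := by
  -- A solution is a fixed point of `T`, which contracts the order topology because each `a i` has
  -- zero constant term.
  let T : (ℕ → MvPowerSeries σ k) → ℕ → MvPowerSeries σ k :=
    fun u j => f j - ∑ i ∈ s, a i * u (j + i)
  have hT : ∀ (n : ℕ) (u v : ℕ → MvPowerSeries σ k), (∀ j, (n : ℕ∞) ≤ (u j - v j).order) →
      ∀ j, ((n + 1 : ℕ) : ℕ∞) ≤ (T u j - T v j).order := by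
    intro n u v huv j
    have h : T u j - T v j = ∑ i ∈ s, -(a i * (u (j + i) - v (j + i))) := by
      simp only [T, mul_sub, sum_neg_distrib, sum_sub_distrib]
      ring
    rw [h, natCast_le_order_iff]
    intro m hm
    rw [map_sum]
    refine sum_eq_zero fun i hi => ?_
    rw [map_neg, neg_eq_zero]
    refine natCast_le_order_iff.1 ?_ m hm
    refine le_trans ?_ le_order_mul
    rw [Nat.cast_add, add_comm (n : ℕ∞)]
    exact add_le_add (by exact_mod_cast one_le_order_iff_constCoeff_eq_zero.2 (ha i hi)) (huv _)
  let u : ℕ → ℕ → MvPowerSeries σ k := fun n => T^[n] 0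
  have hu : ∀ n, u (n + 1) = T (u n) := fun n => Function.iterate_succ_apply' T n 0
  have hstep : ∀ (n : ℕ) (j : ℕ), (n : ℕ∞) ≤ (u (n + 1) j - u n j).order := by
    intro n
    induction n with
    | zero => simp
    | succ n ih =>
      intro j
      rw [hu (n + 1), hu n]
      rw [hu n] at ih
      exact hT n _ _ ih j
  have hstable : ∀ (m : σ →₀ ℕ) j n, coeff m (u (m.degree + 1 + n) j) =
      coeff m (u (m.degree + 1) j) := by
    intro m j n
    induction n with
    | zero => rfl
    | succ n ih =>
      rw [← ih, ← sub_eq_zero, ← map_sub]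
      exact natCast_le_order_iff.1 (hstep _ j) m (by lia)
  -- The limit of the iterates: the coefficient at `m` is stable from step `m.degree + 1` on.
  let g : ℕ → MvPowerSeries σ k := fun j m => coeff m (u (m.degree + 1) j)
  have hg : ∀ (n : ℕ) (j : ℕ), (n : ℕ∞) ≤ (g j - u n j).order := by
    intro n j
    rw [natCast_le_order_iff]
    intro m hm
    obtain ⟨d, rfl⟩ := Nat.exists_eq_add_of_lt hm
    rw [map_sub, sub_eq_zero, show m.degree + d + 1 = m.degree + 1 + d by ring, hstable]
    rfl
  refine ⟨g, fun j => ?_⟩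
  have hfix : g j = T g j := by
    ext m
    rw [← sub_eq_zero, ← map_sub]
    have h : g j - T g j = (g j - u (m.degree + 2) j) + (T (u (m.degree + 1)) j - T g j) := by
      rw [← hu]
      ring
    rw [h, map_add, natCast_le_order_iff.1 (hg _ j) m (by lia), zero_add]
    refine natCast_le_order_iff.1 (hT (m.degree + 1) _ _ (fun i => ?_) j) m (by lia)
    rw [← order_neg, neg_sub]
    exact hg _ i
  rw [← eq_sub_iff_add_eq]
  exact hfix

/-- Division of a power series by a distinguished polynomial. -/
theorem exists_eq_lowPoly_add_monicPoly_mul {q : ℕ} {a : ℕ → MvPowerSeries σ k}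
    (ha : ∀ i ∈ Icc 1 q, constantCoeff (a i) = 0) (f : PowerSeries (MvPowerSeries σ k)) :
    ∃ c g, f = PowerSeries.lowPoly q c + PowerSeries.monicPoly q a * g := by
  obtain ⟨g, hg⟩ := exists_solution_of_constantCoeff_eq_zero (Icc 1 q) a ha
    fun j => PowerSeries.coeff (q + j) f
  refine ⟨fun j => PowerSeries.coeff j (f - PowerSeries.monicPoly q a * PowerSeries.mk g),
    PowerSeries.mk g, ?_⟩
  ext1 n
  rw [map_add, PowerSeries.coeff_lowPoly]
  split_ifs with hn
  · rw [map_sub, sub_add_cancel]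
  · obtain ⟨j, rfl⟩ := Nat.exists_eq_add_of_le (not_lt.1 hn)
    rw [PowerSeries.coeff_monicPoly_mul, zero_add]
    simp [hg j]

/-- The expansion of a power series in powers of a distinguished polynomial. -/
theorem exists_monicPoly_expansion {q : ℕ} {a : ℕ → MvPowerSeries σ k}
    (ha : ∀ i ∈ Icc 1 q, constantCoeff (a i) = 0) (f : PowerSeries (MvPowerSeries σ k)) :
    ∃ c : ℕ → ℕ → MvPowerSeries σ k, ∀ N, PowerSeries.monicPoly q a ^ N ∣
      f - ∑ b ∈ range N, PowerSeries.lowPoly q (c b) * PowerSeries.monicPoly q a ^ b := by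
  choose c g hcg using exists_eq_lowPoly_add_monicPoly_mul ha
  refine ⟨fun b => c (g^[b] f), fun N => ⟨g^[N] f, ?_⟩⟩
  induction N with
  | zero => simp
  | succ N ih =>
    rw [sum_range_succ, ← sub_sub, ih, Function.iterate_succ_apply']
    nth_rw 1 [hcg (g^[N] f)]
    ring

end MvPowerSeries

/-- A special case of the theorem of Lucas on binomial coefficients. -/
theorem cast_choose_add_mul_expChar_pow {k : Type*} [Ring k] (p : ℕ) [ExpChar k p] (e b d : ℕ)
    (hd : d < p ^ e) : ((d + b * p ^ e).choose (b * p ^ e) : k) = 1 := by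
  -- In characteristic zero `p = 1`, so `d = 0`. Otherwise one base `p` digit is removed at a time.
  rcases ‹ExpChar k p› with _ | ⟨hp⟩
  · rw [one_pow, Nat.lt_one_iff] at hd
    simp [hd]
  · rename_i hchar
    have : Fact p.Prime := ⟨hp⟩
    have key : (d + b * p ^ e).choose (b * p ^ e) ≡ 1 [MOD p] := by
      induction e generalizing d with
      | zero =>
        rw [pow_zero, Nat.lt_one_iff] at hd
        simpa [hd] using Nat.ModEq.refl 1
      | succ e ih =>
        refine (Choose.choose_modEq_choose_mod_mul_choose_div_nat).trans ?_
        have h1 : b * p ^ (e + 1) = b * p ^ e * p := by ring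
        rw [h1, Nat.mul_mod_left, Nat.choose_zero_right, one_mul,
          Nat.mul_div_cancel _ hp.pos, Nat.add_mul_div_right _ _ hp.pos]
        exact ih _ (Nat.div_lt_of_lt_mul (by rwa [pow_succ'] at hd))
    have := (CharP.cast_eq_iff_mod_eq k p).2 key
    simpa using this

/-! ### Taylor expansion of power series. -/

namespace PowerSeries

section Taylor

variable {R : Type*} [CommRing R]

/-- Each coefficient depends on finitely many coefficients of `f` and `g`, so the Leibniz rule for
polynomials applies to truncations. -/
theorem hasse_mul (n : ℕ) (f g : R⟦X⟧) :
    hasse n (f * g) = ∑ u ∈ antidiagonal n, hasse u.1 f * hasse u.2 g := by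
  ext m
  have htr : ∀ (i j : ℕ) (f : R⟦X⟧), i + j ≤ m + n →
      (Polynomial.hasseDeriv i (trunc (m + n + 1) f)).coeff j = coeff j (hasse i f) := by
    intro i j f hij
    rw [Polynomial.hasseDeriv_coeff, coeff_trunc, if_pos (by lia), hasse, coeff_mk]
  have hpoly := congrArg (Polynomial.coeff · m)
    (Polynomial.hasseDeriv_mul n (trunc (m + n + 1) f) (trunc (m + n + 1) g))
  simp only [Polynomial.finsetSum_coeff, Polynomial.coeff_mul] at hpoly
  rw [map_sum]
  have hl : coeff m (hasse n (f * g)) =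
      (Polynomial.hasseDeriv n (trunc (m + n + 1) f * trunc (m + n + 1) g)).coeff m := by
    rw [Polynomial.hasseDeriv_coeff, hasse, coeff_mk]
    congr 1
    rw [coeff_mul_eq_coeff_trunc_mul_trunc f g (show m + n < m + n + 1 by lia),
      ← Polynomial.coe_mul, Polynomial.coeff_coe]
  rw [hl, hpoly]
  refine sum_congr rfl fun u hu => ?_
  rw [coeff_mul]
  refine sum_congr rfl fun v hv => ?_
  have hu' := mem_antidiagonal.1 hu
  have hv' := mem_antidiagonal.1 hv
  rw [htr _ _ _ (by lia), htr _ _ _ (by lia)]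

/-- The Taylor expansion `f(X) ↦ f(X + T)`, as a power series in `T`. -/
noncomputable def taylor : R⟦X⟧ →+* R⟦X⟧⟦X⟧ where
  toFun f := mk fun n => hasse n f
  map_one' := by
    ext n m
    simp only [coeff_mk, hasse, coeff_one, Nat.add_eq_zero_iff]
    by_cases hn : n = 0
    · by_cases hm : m = 0 <;> simp [hn, hm, coeff_one]
    · simp [hn]
  map_mul' f g := by
    ext1 n
    rw [coeff_mk, hasse_mul, coeff_mul]
    simp
  map_zero' := by
    ext n m
    simp [hasse]
  map_add' f g := by
    ext n m
    simp [hasse, mul_add]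

theorem coeff_taylor (n : ℕ) (f : R⟦X⟧) : coeff n (taylor f) = hasse n f := by
  simp [taylor]

/-- The interchange of the two variables of `R⟦X⟧⟦X⟧`. -/
noncomputable def swapVars : R⟦X⟧⟦X⟧ →+* R⟦X⟧⟦X⟧ where
  toFun f := mk fun n => mk fun m => coeff n (coeff m f)
  map_one' := by
    ext n m
    simp only [coeff_mk, coeff_one]
    split_ifs <;> simp [coeff_one, *]
  map_mul' f g := by
    ext n m
    simp only [coeff_mk, coeff_mul, map_sum]
    rw [sum_comm]
  map_zero' := by
    ext n m
    simp
  map_add' f g := by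
    ext n m
    simp

theorem coeff_coeff_swapVars (n m : ℕ) (f : R⟦X⟧⟦X⟧) :
    coeff m (coeff n (swapVars f)) = coeff n (coeff m f) := by
  simp [swapVars]

end Taylor

end PowerSeries

/-! ### Two variables: restriction to a coordinate line, weighted order, `p^e`-th powers. -/

namespace MvPowerSeries

variable {k : Type*} [Field k]

/-- The restriction to `{X i = 0}` of a power series in two variables. -/
noncomputable def restrict (i : Fin 2) : MvPowerSeries (Fin 2) k →+* PowerSeries k where
  toFun f := PowerSeries.mk fun n => coeff (Finsupp.single (1 - i) n) f
  map_one' := by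
    ext n
    simp [coeff_one, PowerSeries.coeff_one]
  map_mul' f g := by
    ext n
    rw [PowerSeries.coeff_mk, PowerSeries.coeff_mul, coeff_mul, Finsupp.antidiagonal_single,
      sum_map]
    simp
  map_zero' := by
    ext n
    simp
  map_add' f g := by
    ext n
    simp

theorem coeff_restrict (i : Fin 2) (f : MvPowerSeries (Fin 2) k) (n : ℕ) :
    PowerSeries.coeff n (restrict i f) = coeff (Finsupp.single (1 - i) n) f := by
  simp [restrict]

theorem _root_.Finsupp.eq_single_one_sub {i : Fin 2} {m : Fin 2 →₀ ℕ} (hm : m i = 0) :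
    m = Finsupp.single (1 - i) (m (1 - i)) := by
  ext j
  fin_cases i <;> fin_cases j <;> simp_all

theorem single_one_sub_apply (i : Fin 2) (n : ℕ) : Finsupp.single (1 - i) n i = 0 := by
  fin_cases i <;> simp

theorem restrict_eq_zero_iff {i : Fin 2} {f : MvPowerSeries (Fin 2) k} :
    restrict i f = 0 ↔ X i ∣ f := by
  rw [X_dvd_iff]
  constructor
  · intro h m hm
    rw [Finsupp.eq_single_one_sub hm, ← coeff_restrict, h, map_zero]
  · intro h
    ext n
    rw [coeff_restrict, h _ (single_one_sub_apply i n), map_zero]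

theorem restrict_X (i : Fin 2) : restrict i (X (1 - i) : MvPowerSeries (Fin 2) k) =
    PowerSeries.X := by
  ext n
  rw [coeff_restrict, coeff_X, PowerSeries.coeff_X]
  exact if_congr (Finsupp.single_injective _).eq_iff rfl rfl

theorem constantCoeff_restrict (i : Fin 2) (f : MvPowerSeries (Fin 2) k) :
    PowerSeries.constantCoeff (restrict i f) = constantCoeff f := by
  rw [← PowerSeries.coeff_zero_eq_constantCoeff_apply, coeff_restrict]
  simp

theorem restrict_surjective (i : Fin 2) :
    Function.Surjective (restrict i : MvPowerSeries (Fin 2) k →+* PowerSeries k) := by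
  intro g
  let f : MvPowerSeries (Fin 2) k := fun m => PowerSeries.coeff (m (1 - i)) g
  refine ⟨f, ?_⟩
  ext n
  rw [coeff_restrict]
  change PowerSeries.coeff (Finsupp.single (1 - i) n (1 - i)) g = _
  rw [Finsupp.single_eq_same]

theorem prime_X (i : Fin 2) : Prime (X i : MvPowerSeries (Fin 2) k) := by
  refine ⟨fun h => ?_, fun h => ?_, fun f g h => ?_⟩
  · have := congrArg (coeff (Finsupp.single i 1)) h
    simp [coeff_X] at this
  · have := h.map (constantCoeff (σ := Fin 2) (R := k))
    simp at this
  · rw [← restrict_eq_zero_iff, map_mul, mul_eq_zero] at h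
    simpa only [restrict_eq_zero_iff] using h

theorem not_X_dvd_X (i : Fin 2) : ¬ (X i : MvPowerSeries (Fin 2) k) ∣ X (1 - i) := by
  rw [← restrict_eq_zero_iff, restrict_X]
  exact PowerSeries.X_ne_zero

/-- The restriction to `X i = 0` is a nonzero series in one variable, hence a unit times a power;
any lift of the unit is a unit. -/
theorem exists_eq_X_pow_mul_add {i : Fin 2} {f : MvPowerSeries (Fin 2) k} (hf : ¬ X i ∣ f) :
    ∃ n u c, IsUnit u ∧ f = X (1 - i) ^ n * u + X i * c := by
  rw [← restrict_eq_zero_iff] at hf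
  obtain ⟨n, v, hv⟩ := IsDiscreteValuationRing.eq_unit_mul_pow_irreducible hf
    (PowerSeries.X_prime (R := k)).irreducible
  obtain ⟨u, hu⟩ := restrict_surjective i (v : PowerSeries k)
  have hunit : IsUnit u := by
    rw [MvPowerSeries.isUnit_iff_constantCoeff, ← constantCoeff_restrict i, hu]
    exact v.isUnit.map _
  have hdvd : X i ∣ f - X (1 - i) ^ n * u := by
    rw [← restrict_eq_zero_iff, map_sub, map_mul, map_pow, restrict_X, hu, hv]
    ring
  obtain ⟨c, hc⟩ := hdvd
  exact ⟨n, u, c, hunit, by rw [← hc]; ring⟩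

/-- An ideal that contains `X i` and is disjoint from the powers of the other variable consists of
multiples of `X i`. -/
theorem X_dvd_of_mem {I : Ideal (MvPowerSeries (Fin 2) k)} {i : Fin 2} (hI : I.IsPrime)
    (hi : X i ∈ I) (hi' : X (1 - i) ∉ I) {f : MvPowerSeries (Fin 2) k} (hf : f ∈ I) : X i ∣ f := by
  by_contra h
  obtain ⟨n, u, c, hu, rfl⟩ := exists_eq_X_pow_mul_add h
  have h1 := (Ideal.add_mem_iff_left I (I.mul_mem_right c hi)).1 hf
  rw [Ideal.mul_unit_mem_iff_mem I hu] at h1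
  exact hi' (hI.mem_of_pow_mem n h1)

theorem mem_of_constantCoeff_eq_zero {I : Ideal (MvPowerSeries (Fin 2) k)} {i : Fin 2}
    (hi : X i ∈ I) (hi' : X (1 - i) ∈ I) {f : MvPowerSeries (Fin 2) k}
    (hf : constantCoeff f = 0) : f ∈ I := by
  obtain ⟨c, hc⟩ : PowerSeries.X ∣ restrict i f := by
    rw [PowerSeries.X_dvd_iff, constantCoeff_restrict, hf]
  obtain ⟨d, rfl⟩ := restrict_surjective i c
  have h : X i ∣ f - X (1 - i) * d := by
    rw [← restrict_eq_zero_iff, map_sub, map_mul, restrict_X, hc, sub_self]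
  rw [← sub_add_cancel f (X (1 - i) * d)]
  exact add_mem (I.mem_of_dvd h hi) (I.mul_mem_right _ hi')

theorem weight_single_one (i : Fin 2) (m : Fin 2 →₀ ℕ) :
    Finsupp.weight (Pi.single i 1 : Fin 2 → ℕ) m = m i := by
  rw [Finsupp.weight_apply, Finsupp.sum_fintype _ _ (by simp)]
  simp [Pi.single_apply]

theorem natCast_le_weightedOrder_single_iff {i : Fin 2} {n : ℕ} {f : MvPowerSeries (Fin 2) k} :
    (n : ℕ∞) ≤ f.weightedOrder (Pi.single i 1) ↔ X i ^ n ∣ f := by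
  rw [X_pow_dvd_iff]
  constructor
  · intro h m hm
    refine coeff_eq_zero_of_lt_weightedOrder (Pi.single i 1) (lt_of_lt_of_le ?_ h)
    rw [weight_single_one]
    exact_mod_cast hm
  · intro h
    refine nat_le_weightedOrder _ fun m hm => h m ?_
    rwa [weight_single_one] at hm

/-- Such an `f` is a series in the `p^e`-th powers of the variables. Its coefficients have `p^e`-th
roots because `k` is perfect, and Frobenius is additive. -/
theorem exists_pow_eq_of_coeff_eq_zero [IsAlgClosed k] (p : ℕ) [ExpChar k p] (e : ℕ)
    {f : MvPowerSeries (Fin 2) k} (hf : ∀ m i, ¬ p ^ e ∣ m i → coeff m f = 0) :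
    ∃ u, u ^ p ^ e = f := by
  have hq : p ^ e ≠ 0 := (expChar_pow_pos k p e).ne'
  let v : MvPowerSeries (Fin 2) k := fun m => coeff (p ^ e • m) f
  have hv : expand (p ^ e) hq v = f := by
    ext m
    by_cases hm : ∀ i, p ^ e ∣ m i
    · choose d hd using hm
      have hmd : m = p ^ e • Finsupp.equivFunOnFinite.symm d := by
        ext i
        simp [hd i]
      rw [hmd, coeff_expand_smul]
      rfl
    · rw [not_forall] at hm
      obtain ⟨i, hi⟩ := hm
      rw [hf m i hi, coeff_expand_of_not_dvd _ _ _ hi]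
  refine ⟨map (iterateFrobeniusEquiv k p e).symm.toRingHom v, ?_⟩
  rw [← map_iterateFrobenius_expand (hp := (expChar_pos k p).ne'), map_expand, ← hv]
  congr 1
  ext m
  rw [coeff_map, coeff_map]
  exact (iterateFrobeniusEquiv k p e).apply_symm_apply _

end MvPowerSeries

/-! ### Vanishing of `X^q + a` to order `q` along a curve. -/

namespace PowerSeries

variable {k : Type*} [Field k]

theorem constantCoeff_swapVars_map_taylor (f : k⟦X⟧⟦X⟧) :
    coeff 0 (swapVars (map taylor f)) = f := by
  ext1 m
  rw [coeff_coeff_swapVars, coeff_map, coeff_taylor]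
  ext j
  simp [hasse]

theorem coeff_swapVars_map_taylor (q n : ℕ) (hn : n ≠ 0) (a : k⟦X⟧) :
    coeff n (swapVars (map taylor (X ^ q + C a))) = C (hasse n a) := by
  ext1 m
  rw [coeff_coeff_swapVars, coeff_map, map_add, map_add, map_add, coeff_X_pow, coeff_C, coeff_C]
  split_ifs <;> simp [coeff_taylor, coeff_one, hn]

/-- If `X ^ q + a` vanishes to order `q` along a curve that does not lie over the closed point,
then the divided derivatives of `a` of order between `1` and `q - 1` vanish. -/
theorem hasse_eq_zero_of_mul_mem_pow {I : Ideal k⟦X⟧⟦X⟧} (hI : I.IsPrime) (hX : C X ∉ I) {q : ℕ}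
    {a : k⟦X⟧} {s : k⟦X⟧⟦X⟧} (hs : s ∉ I) (h : s * (X ^ q + C a) ∈ I ^ q) {n : ℕ} (hn : n ≠ 0)
    (hnq : n < q) : hasse n a = 0 := by
  -- Translate the inner variable by a new variable `T`, then reduce the coefficients of the powers
  -- of `T` modulo `I`. The constant term of `Φ f` is the class of `f`, so `I ^ q` lands in the
  -- multiples of `T^q`, while `s ∉ I` keeps `Φ s` prime to `T`.
  let Φ : k⟦X⟧⟦X⟧ →+* (k⟦X⟧⟦X⟧ ⧸ I)⟦X⟧ :=
    (map (Ideal.Quotient.mk I)).comp (swapVars.comp (map taylor))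
  have hΦ : ∀ f j, coeff j (Φ f) = Ideal.Quotient.mk I (coeff j (swapVars (map taylor f))) :=
    fun f j => by simp only [Φ, RingHom.comp_apply, coeff_map]
  have hmem : ∀ f, X ∣ Φ f ↔ f ∈ I := by
    intro f
    rw [X_dvd_iff, ← coeff_zero_eq_constantCoeff_apply, hΦ, constantCoeff_swapVars_map_taylor,
      Ideal.Quotient.eq_zero_iff_mem]
  have hpow : I ^ q ≤ (Ideal.span {X ^ q}).comap Φ := by
    rw [← Ideal.span_singleton_pow]
    refine le_trans (Ideal.pow_right_mono (fun f hf => ?_) q) (Ideal.le_comap_pow Φ q)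
    rw [Ideal.mem_comap, Ideal.mem_span_singleton]
    exact (hmem f).2 hf
  have hdvd := hpow h
  rw [Ideal.mem_comap, Ideal.mem_span_singleton, map_mul] at hdvd
  have hdvd' := X_prime.pow_dvd_of_dvd_mul_left q (fun hXs => hs ((hmem s).1 hXs)) hdvd
  have hn0 := X_pow_dvd_iff.1 hdvd' n hnq
  rw [hΦ, coeff_swapVars_map_taylor q n hn, Ideal.Quotient.eq_zero_iff_mem] at hn0
  -- A nonzero series in the inner variable is a unit times a power of it, and that variable is not
  -- in `I`.
  by_contra hne
  obtain ⟨m, u, hu⟩ := IsDiscreteValuationRing.eq_unit_mul_pow_irreducible hne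
    (X_prime (R := k)).irreducible
  rw [hu, map_mul, Ideal.unit_mul_mem_iff_mem I (u.isUnit.map _), map_pow] at hn0
  exact hX (hI.mem_of_pow_mem m hn0)

/-- Differentiate to order `m % p^e`: the coefficient of degree `m - m % p^e` is that of `a` at `m`
times a binomial coefficient which is `1` in `k` by Lucas. -/
theorem coeff_eq_zero_of_hasse_eq_zero (p : ℕ) [ExpChar k p] (e : ℕ) {a : k⟦X⟧}
    (h : ∀ n, n ≠ 0 → n < p ^ e → hasse n a = 0) {m : ℕ} (hm : ¬ p ^ e ∣ m) : coeff m a = 0 := by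
  have hq : 0 < p ^ e := expChar_pow_pos k p e
  have hd := congrArg (coeff (m / p ^ e * p ^ e))
    (h (m % p ^ e) (fun h0 => hm (Nat.dvd_of_mod_eq_zero h0)) (Nat.mod_lt _ hq))
  rw [hasse, coeff_mk, add_comm, Nat.choose_symm_add,
    cast_choose_add_mul_expChar_pow p e _ _ (Nat.mod_lt _ hq), one_mul, Nat.mod_add_div'] at hd
  simpa using hd

end PowerSeries

/-! ### Support and symbolic powers. -/

namespace IdealisticFiltration

variable {A : Type*} [CommRing A] {R : IdealisticFiltration A} {Q : PrimeSpectrum A}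

theorem exists_mul_mem_pow_of_mem_support (hQ : Q ∈ R.support) {n : ℕ} {f : A}
    (hf : f ∈ R.level n) : ∃ s ∉ Q.asIdeal, s * f ∈ Q.asIdeal ^ n := by
  have h := hQ n (Ideal.mem_map_of_mem _ hf)
  rw [← Localization.AtPrime.map_eq_maximalIdeal, ← Ideal.map_pow,
    IsLocalization.mem_map_algebraMap_iff Q.asIdeal.primeCompl] at h
  obtain ⟨⟨g, s⟩, hgs⟩ := h
  rw [← map_mul, IsLocalization.eq_iff_exists Q.asIdeal.primeCompl] at hgs
  obtain ⟨c, hc⟩ := hgs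
  refine ⟨c * s, (c * s).2, ?_⟩
  have : (c : A) * s * f = c * g := by
    rw [← hc]
    ring
  rw [this]
  exact Ideal.mul_mem_left _ _ g.2

theorem mem_support_of_level_le (h : ∀ n, R.level n ≤ Q.asIdeal ^ n) : Q ∈ R.support := by
  intro n
  rw [← Localization.AtPrime.map_eq_maximalIdeal, ← Ideal.map_pow]
  exact Ideal.map_mono (h n)

end IdealisticFiltration

/-! ### Transport to `k[[x, y]][[z]]`. -/

namespace MonomialData

open PowerSeries

variable {k A : Type*} [Field k] [CommRing A] [Algebra k A]

/-- The ideal of `k[[x, y, z]]` that corresponds to an ideal of `A`. -/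
noncomputable def modelIdeal (S : MonomialData k A) (I : Ideal A) : Ideal (Model k) :=
  I.comap (S.coord : Model k ≃+* A)

variable (S : MonomialData k A)

theorem mem_modelIdeal {I : Ideal A} {f : Model k} : f ∈ S.modelIdeal I ↔ S.coord f ∈ I := Iff.rfl

theorem modelIdeal_pow (I : Ideal A) (n : ℕ) : S.modelIdeal (I ^ n) = S.modelIdeal I ^ n := by
  rw [modelIdeal, modelIdeal, ← Ideal.map_symm, ← Ideal.map_symm, Ideal.map_pow]

theorem modelIdeal_injective : Function.Injective S.modelIdeal := by
  intro I J h
  ext f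
  rw [← S.coord.apply_symm_apply f, ← mem_modelIdeal, h, mem_modelIdeal]

instance isPrime_modelIdeal (I : Ideal A) [I.IsPrime] : (S.modelIdeal I).IsPrime :=
  Ideal.comap_isPrime _ I

theorem C_X_mem_modelIdeal {I : Ideal A} {i : Fin 2} :
    C (MvPowerSeries.X i) ∈ S.modelIdeal I ↔ S.par i ∈ I := Iff.rfl

theorem h_eq (p : ℕ) : S.h p = S.coord (monicPoly (p ^ S.e) S.coeff) := by
  simp [h, monicPoly, z, ofBase]

theorem poly_eq (p : ℕ) (c : ℕ → Base k) : S.poly p c = S.coord (lowPoly (p ^ S.e) c) := by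
  simp [poly, lowPoly, z, ofBase]

theorem prod_par_pow_eq (n : Fin 2 → ℕ) :
    ∏ i, S.par i ^ n i = S.coord (C (∏ i, MvPowerSeries.X i ^ n i)) := by
  simp [par, ofBase]

theorem exists_mul_mem_pow {R : IdealisticFiltration A} {Q : PrimeSpectrum A} (hQ : Q ∈ R.support)
    {n : ℕ} {f : Model k} (hf : S.coord f ∈ R.level n) :
    ∃ s ∉ S.modelIdeal Q.asIdeal, s * f ∈ S.modelIdeal Q.asIdeal ^ n := by
  obtain ⟨s, hs, hsf⟩ := IdealisticFiltration.exists_mul_mem_pow_of_mem_support hQ hf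
  refine ⟨S.coord.symm s, ?_, ?_⟩
  · rwa [mem_modelIdeal, S.coord.apply_symm_apply]
  · rwa [← modelIdeal_pow, mem_modelIdeal, map_mul, S.coord.apply_symm_apply]

theorem mem_modelIdeal_of_mem_support {R : IdealisticFiltration A} {Q : PrimeSpectrum A}
    (hQ : Q ∈ R.support) {n : ℕ} (hn : n ≠ 0) {f : Model k} (hf : S.coord f ∈ R.level n) :
    f ∈ S.modelIdeal Q.asIdeal := by
  obtain ⟨s, hs, hsf⟩ := S.exists_mul_mem_pow hQ hf
  have := (inferInstance : (S.modelIdeal Q.asIdeal).IsPrime)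
  exact (this.mem_or_mem (Ideal.pow_le_self hn hsf)).resolve_left hs

theorem mem_adicIdeal_of_mem_support {R : IdealisticFiltration A} {Q : PrimeSpectrum A}
    (hQ : Q ∈ R.support) {i : Fin 2}
    (hQi : S.modelIdeal Q.asIdeal = adicIdeal (MvPowerSeries.X i) 1)
    {n : ℕ} {f : Model k} (hf : S.coord f ∈ R.level n) : f ∈ adicIdeal (MvPowerSeries.X i) n := by
  obtain ⟨s, hs, hsf⟩ := S.exists_mul_mem_pow hQ hf
  rw [hQi] at hs hsf
  have : IsDomain (Base k) := NoZeroDivisors.to_isDomain _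
  exact mem_adicIdeal_of_mul_mem (MvPowerSeries.prime_X i) hs (adicIdeal_one_pow_le _ _ hsf)

theorem eq_closedPoint_of_mem [IsLocalRing A] {Q : PrimeSpectrum A} {i : Fin 2}
    (hz : S.z ∈ Q.asIdeal) (hi : S.par i ∈ Q.asIdeal) (hi' : S.par (1 - i) ∈ Q.asIdeal) :
    Q = IsLocalRing.closedPoint A := by
  refine PrimeSpectrum.ext (le_antisymm (IsLocalRing.le_maximalIdeal Q.isPrime.ne_top) ?_)
  intro f hf
  obtain ⟨g, rfl⟩ := S.coord.surjective f
  have hg : MvPowerSeries.constantCoeff (constantCoeff g) = 0 := by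
    by_contra hne
    have hu : IsUnit g := by
      rw [isUnit_iff_constantCoeff, MvPowerSeries.isUnit_iff_constantCoeff]
      exact isUnit_iff_ne_zero.2 hne
    exact (IsLocalRing.mem_maximalIdeal _).1 hf (hu.map S.coord)
  change g ∈ S.modelIdeal Q.asIdeal
  rw [eq_X_mul_shift_add_const g]
  refine add_mem (Ideal.mul_mem_right _ _ hz) ?_
  exact MvPowerSeries.mem_of_constantCoeff_eq_zero
    (I := (S.modelIdeal Q.asIdeal).comap (C (R := Base k))) hi hi' hg

/-- The contraction of `Q` to `k[[x, y]]` contains one variable and not the other, so it is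
generated by the former. -/
theorem modelIdeal_eq_adicIdeal {Q : PrimeSpectrum A} {i : Fin 2}
    (hz : S.z ∈ Q.asIdeal) (hi : S.par i ∈ Q.asIdeal) (hi' : S.par (1 - i) ∉ Q.asIdeal) :
    S.modelIdeal Q.asIdeal = adicIdeal (MvPowerSeries.X i) 1 := by
  refine le_antisymm (fun f hf => ?_) (adicIdeal_one_le hz hi)
  rw [mem_adicIdeal_one]
  have hprime : ((S.modelIdeal Q.asIdeal).comap (C (R := Base k))).IsPrime :=
    Ideal.comap_isPrime _ _
  refine MvPowerSeries.X_dvd_of_mem hprime hi hi' ?_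
  rw [Ideal.mem_comap]
  rw [eq_X_mul_shift_add_const f] at hf
  exact ((S.modelIdeal Q.asIdeal).add_mem_iff_right (Ideal.mul_mem_right _ _ hz)).1 hf

theorem one_le_mu_iff (hlev : 0 < S.lev) (i : Fin 2) :
    1 ≤ S.mu (atDiv i) ↔ S.lev ≤ S.expo i := by
  rw [mu, ENNReal.le_div_iff_mul_le (by simp [hlev.ne']) (by simp), one_mul]
  simp [atDiv, Pi.single_apply]

theorem mu_atDiv (i : Fin 2) : S.mu (atDiv i) = (S.expo i : ℝ≥0∞) / S.lev := by
  simp [mu, atDiv, Pi.single_apply]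

theorem one_le_lastOrd_iff {p : ℕ} (hp : 0 < p) (i : Fin 2) :
    1 ≤ S.lastOrd p (atDiv i) ↔ MvPowerSeries.X i ^ p ^ S.e ∣ S.coeff (p ^ S.e) := by
  have hq : p ^ S.e ≠ 0 := (pow_pos hp _).ne'
  rw [lastOrd, ENNReal.le_div_iff_mul_le (.inl (by exact_mod_cast hq)) (by simp), one_mul,
    ← MvPowerSeries.natCast_le_weightedOrder_single_iff, ← ENat.toENNReal_le]
  simp [atDiv]

/-! ### Slope at least one puts a curve in the support. -/

namespace IsSituation

variable {S} [IsLocalRing A] {p : ℕ} {R : IdealisticFiltration A} {E : Set (Ideal A)}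

theorem constantCoeff_coeff (hS : S.IsSituation p R E) {i : ℕ} (hi : i ∈ Icc 1 (p ^ S.e)) :
    MvPowerSeries.constantCoeff (S.coeff i) = 0 := by
  have h := hS.lt_order i hi
  rw [← MvPowerSeries.one_le_order_iff_constCoeff_eq_zero]
  refine le_trans ?_ h.le
  exact_mod_cast (mem_Icc.1 hi).1

theorem pow_dvd_of_isExpansion (hS : S.IsSituation p R E) {l : ℕ} {f : A} (hf : f ∈ R.level l)
    {c : ℕ → ℕ → Base k} (hc : S.IsExpansion p f c) (i : Fin 2) {j : ℕ} (hj : j < p ^ S.e) :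
    MvPowerSeries.X i ^ ⌈((l * S.expo i : ℕ) : ℚ) / S.lev⌉₊ ∣ c 0 j := by
  have h := hS.monomial_dvd l f hf c hc
  rw [prod_par_pow_eq, poly_eq, map_dvd_iff] at h
  obtain ⟨g, hg⟩ := h
  have hj' := congrArg (PowerSeries.coeff j) hg
  rw [coeff_lowPoly, if_pos hj, coeff_C_mul] at hj'
  rw [hj']
  exact (dvd_prod_of_mem (fun i => (MvPowerSeries.X i : Base k) ^
    ⌈((l * S.expo i : ℕ) : ℚ) / S.lev⌉₊) (mem_univ i)).mul_right _

theorem exists_eq_lowPoly_add (hS : S.IsSituation p R E) {l : ℕ} {f : Model k}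
    (hf : S.coord f ∈ R.level l) :
    ∃ c g, f = lowPoly (p ^ S.e) c + monicPoly (p ^ S.e) S.coeff * g ∧
      ∀ i, ∀ j < p ^ S.e, MvPowerSeries.X i ^ ⌈((l * S.expo i : ℕ) : ℚ) / S.lev⌉₊ ∣ c j := by
  obtain ⟨c, hc⟩ := MvPowerSeries.exists_monicPoly_expansion
    (fun i hi => hS.constantCoeff_coeff hi) f
  have hexp : S.IsExpansion p (S.coord f) c := by
    intro N
    simpa [h_eq, poly_eq, ← map_pow, ← map_mul, ← map_sum, ← map_sub, map_dvd_iff] using hc N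
  obtain ⟨g, hg⟩ := hc 1
  refine ⟨c 0, g, ?_, fun i j hj => hS.pow_dvd_of_isExpansion hf hexp i hj⟩
  rw [pow_one, sum_range_one, pow_zero, mul_one] at hg
  rw [← hg]
  ring

/-- The divided derivative of `h` of order `p^e - i` has level `i` and degree `i < p^e` in `z`, so
it is its own remainder modulo `h`; its constant term is exactly `a_i`. -/
theorem pow_dvd_coeff (hS : S.IsSituation p R E) {i : ℕ} (hi : 0 < i) (hiq : i < p ^ S.e)
    (j : Fin 2) :
    MvPowerSeries.X j ^ ⌈((i * S.expo j : ℕ) : ℚ) / S.lev⌉₊ ∣ S.coeff i := by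
  have hmem := hS.hasse_mem (p ^ S.e - i) _ _ hS.h_mem
  rw [h_eq, S.coord.symm_apply_apply, Nat.sub_sub_self hiq.le] at hmem
  set g := hasseZ (p ^ S.e - i) (monicPoly (p ^ S.e) S.coeff) with hg
  have hcoeff : ∀ n, PowerSeries.coeff n g = ((n + (p ^ S.e - i)).choose (p ^ S.e - i) : Base k) *
      PowerSeries.coeff (n + (p ^ S.e - i)) (monicPoly (p ^ S.e) S.coeff) := by
    intro n
    rw [hg, hasseZ, coeff_mk]
  have hlow : g = lowPoly (p ^ S.e) fun n => PowerSeries.coeff n g := by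
    ext1 n
    rw [coeff_lowPoly]
    split_ifs with hn
    · rfl
    · rw [hcoeff, coeff_monicPoly, if_neg (by lia), if_neg (by lia), mul_zero]
  have hexp : S.IsExpansion p (S.coord g)
      fun b n => if b = 0 then PowerSeries.coeff n g else 0 := by
    intro N
    rcases N with _ | N
    · simp
    · rw [sum_range_succ', sum_eq_zero]
      · simp only [zero_add, if_true, poly_eq, ← hlow, pow_zero, mul_one, sub_self, dvd_zero]
      · intro b _
        simp [poly_eq, lowPoly]
  have h := hS.pow_dvd_of_isExpansion hmem hexp j (show 0 < p ^ S.e by lia)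
  rwa [if_pos rfl, hcoeff, zero_add, Nat.choose_self, Nat.cast_one, one_mul, coeff_monicPoly,
    if_neg (by lia), if_pos (by lia), Nat.sub_sub_self hiq.le] at h

theorem le_ceil (hS : S.IsSituation p R E) {i : Fin 2} (h : S.lev ≤ S.expo i) (l : ℕ) :
    l ≤ ⌈((l * S.expo i : ℕ) : ℚ) / S.lev⌉₊ := by
  have hlev : (0 : ℚ) < S.lev := by exact_mod_cast hS.lev_pos
  have : (l : ℚ) ≤ ((l * S.expo i : ℕ) : ℚ) / S.lev := by
    rw [le_div_iff₀ hlev]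
    exact_mod_cast Nat.mul_le_mul_left l h
  exact_mod_cast this.trans (Nat.le_ceil _)

/-- If the slope along `{x = 0}` is at least one, then the support contains the curve
`{z = x = 0}`. -/
theorem exists_mem_support_of_one_le_slope [ExpChar k p] (hS : S.IsSituation p R E)
    {i : Fin 2} (h : 1 ≤ S.slope p (atDiv i)) :
    ∃ Q ∈ R.support, S.modelIdeal Q.asIdeal = adicIdeal (MvPowerSeries.X i) 1 := by
  obtain ⟨hlast, hmu⟩ := le_min_iff.1 h
  rw [S.one_le_lastOrd_iff (expChar_pos k p)] at hlast
  rw [S.one_le_mu_iff hS.lev_pos] at hmu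
  have hq : 0 < p ^ S.e := expChar_pow_pos k p S.e
  have ha : ∀ j ∈ Icc 1 (p ^ S.e), MvPowerSeries.X i ^ j ∣ S.coeff j := by
    intro j hj
    obtain ⟨hj1, hjq⟩ := mem_Icc.1 hj
    rcases hjq.eq_or_lt with rfl | hlt
    · exact hlast
    · exact (pow_dvd_pow _ (hS.le_ceil hmu j)).trans (hS.pow_dvd_coeff hj1 hlt i)
  have hlevel : ∀ l, ∀ f : Model k, S.coord f ∈ R.level l →
      f ∈ adicIdeal (MvPowerSeries.X i) l := by
    intro l f hf
    refine mem_adicIdeal_of_hasse_stable hq (fun b d hd => ?_) ha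
      (fun l => {f | S.coord f ∈ R.level l}) (fun n l f hf => ?_) (fun l f hf => ?_) hf
    · have := congrArg (MvPowerSeries.C (σ := Fin 2))
        (cast_choose_add_mul_expChar_pow (k := k) p S.e b d hd)
      simpa only [map_natCast, map_one] using this
    · have := hS.hasse_mem n l _ hf
      rwa [S.coord.symm_apply_apply] at this
    · obtain ⟨c, g, hfg, hc⟩ := hS.exists_eq_lowPoly_add hf
      exact ⟨c, g, hfg, fun j hj => (pow_dvd_pow _ (hS.le_ceil hmu l)).trans (hc i j hj)⟩
  have hprime := isPrime_adicIdeal_one (MvPowerSeries.prime_X (k := k) i)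
  let Q : PrimeSpectrum A :=
    ⟨(adicIdeal (MvPowerSeries.X i) 1).comap (S.coord.symm : A ≃+* Model k),
      Ideal.comap_isPrime _ _⟩
  have hQ : S.modelIdeal Q.asIdeal = adicIdeal (MvPowerSeries.X i) 1 := by
    ext f
    change S.coord.symm (S.coord f) ∈ adicIdeal (MvPowerSeries.X i) 1 ↔ _
    rw [S.coord.symm_apply_apply]
  refine ⟨Q, IdealisticFiltration.mem_support_of_level_le fun n f hf => ?_, hQ⟩
  rw [← S.coord.apply_symm_apply f] at hf ⊢
  rw [← mem_modelIdeal, modelIdeal_pow, hQ]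
  exact adicIdeal_le_pow _ _ (hlevel n _ hf)

end IsSituation

end MonomialData

namespace PowerSeries

variable {B : Type*} [CommRing B]

theorem X_mem_of_monicPoly_mem {I : Ideal B⟦X⟧} (hI : I.IsPrime) {q : ℕ} {a : ℕ → B}
    (ha : ∀ j ∈ Icc 1 q, C (a j) ∈ I) (h : monicPoly q a ∈ I) : X ∈ I :=
  hI.mem_of_pow_mem q ((I.add_mem_iff_left
    (sum_mem fun j hj => Ideal.mul_mem_right _ _ (ha j hj))).1 h)

end PowerSeries

namespace MonomialData

variable {k A : Type*} [Field k] [CommRing A] [Algebra k A] [IsLocalRing A] (S : MonomialData k A)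

theorem coord_mem_maximalIdeal {f : Model k}
    (hf : MvPowerSeries.constantCoeff (PowerSeries.constantCoeff f) = 0) :
    S.coord f ∈ IsLocalRing.maximalIdeal A := by
  refine (IsLocalRing.mem_maximalIdeal _).2 fun hu => ?_
  have hu' : IsUnit f := (isUnit_map_iff S.coord _).1 hu
  have := (hu'.map (PowerSeries.constantCoeff (R := Base k))).map
    (MvPowerSeries.constantCoeff (σ := Fin 2) (R := k))
  exact this.ne_zero hf

theorem par_mem_maximalIdeal (i : Fin 2) : S.par i ∈ IsLocalRing.maximalIdeal A :=
  S.coord_mem_maximalIdeal (by simp)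

theorem z_mem_maximalIdeal : S.z ∈ IsLocalRing.maximalIdeal A :=
  S.coord_mem_maximalIdeal (by simp)

end MonomialData

/-! ### Points of the support other than the closed point. -/

namespace MonomialData.IsSituation

open PowerSeries

variable {k A : Type*} [Field k] [CommRing A] [Algebra k A] [IsLocalRing A] {p : ℕ}
  {S : MonomialData k A} {R : IdealisticFiltration A} {E : Set (Ideal A)}
  {Q : PrimeSpectrum A} {i : Fin 2}

theorem monicPoly_mem [ExpChar k p] (hS : S.IsSituation p R E) (hQ : Q ∈ R.support) :
    monicPoly (p ^ S.e) S.coeff ∈ S.modelIdeal Q.asIdeal :=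
  S.mem_modelIdeal_of_mem_support hQ (expChar_pow_pos k p S.e).ne' (S.h_eq p ▸ hS.h_mem)

theorem par_one_sub_notMem [ExpChar k p] (hS : S.IsSituation p R E) (hQ : Q ∈ R.support)
    (hi : S.par i ∈ Q.asIdeal) (hQP : Q ≠ IsLocalRing.closedPoint A) :
    S.par (1 - i) ∉ Q.asIdeal := by
  intro hi'
  refine hQP (S.eq_closedPoint_of_mem ?_ hi hi')
  refine X_mem_of_monicPoly_mem (S.isPrime_modelIdeal Q.asIdeal) (fun j hj => ?_)
    (hS.monicPoly_mem hQ)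
  exact MvPowerSeries.mem_of_constantCoeff_eq_zero
    (I := (S.modelIdeal Q.asIdeal).comap (C (R := Base k))) hi hi' (hS.constantCoeff_coeff hj)

theorem exists_par_mem (hS : S.IsSituation p R E) (hQ : Q ∈ R.support) :
    ∃ i, S.expo i ≠ 0 ∧ S.par i ∈ Q.asIdeal := by
  have hmem := hS.monomial_mem
  rw [prod_par_pow_eq] at hmem
  have h := S.mem_modelIdeal_of_mem_support hQ hS.lev_pos.ne' hmem
  rw [mem_modelIdeal, ← prod_par_pow_eq, Q.isPrime.prod_mem_iff] at h
  obtain ⟨i, -, hi⟩ := h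
  refine ⟨i, fun h0 => ?_, Q.isPrime.mem_of_pow_mem _ hi⟩
  rw [h0, pow_zero] at hi
  exact Q.isPrime.ne_top ((Ideal.eq_top_iff_one _).2 hi)

theorem X_dvd_coeff_of_lt (hS : S.IsSituation p R E) (hexp : S.expo i ≠ 0) {j : ℕ} (hj : 0 < j)
    (hjq : j < p ^ S.e) : MvPowerSeries.X i ∣ S.coeff j := by
  refine dvd_trans (dvd_pow_self _ ?_) (hS.pow_dvd_coeff hj hjq i)
  have hlev : (0 : ℚ) < S.lev := by exact_mod_cast hS.lev_pos
  have hpos : (0 : ℚ) < ((j * S.expo i : ℕ) : ℚ) := by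
    exact_mod_cast Nat.mul_pos hj (Nat.pos_of_ne_zero hexp)
  exact (Nat.ceil_pos.2 (div_pos hpos hlev)).ne'

/-- If the support contains a curve in `{x = 0}`, then the restriction of `a_(p^e)` to `{x = 0}` is
a power series in `y^(p^e)`. -/
theorem coeff_restrict_eq_zero [ExpChar k p] (hS : S.IsSituation p R E) (hQ : Q ∈ R.support)
    (hi : S.par i ∈ Q.asIdeal) (hi' : S.par (1 - i) ∉ Q.asIdeal) (hexp : S.expo i ≠ 0) {m : ℕ}
    (hm : ¬ p ^ S.e ∣ m) :
    PowerSeries.coeff m (MvPowerSeries.restrict i (S.coeff (p ^ S.e))) = 0 := by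
  have hq : 0 < p ^ S.e := expChar_pow_pos k p S.e
  let π : Model k →+* k⟦X⟧⟦X⟧ := PowerSeries.map (MvPowerSeries.restrict i)
  have hπ : Function.Surjective π :=
    PowerSeries.map_surjective _ (MvPowerSeries.restrict_surjective i)
  -- The kernel consists of multiples of `X i`, which lies in `Q`; hence the image of `Q` is prime
  -- and its preimage is `Q` again.
  have hker : RingHom.ker π ≤ S.modelIdeal Q.asIdeal := by
    intro f hf
    have hdvd : ∀ j, MvPowerSeries.X i ∣ PowerSeries.coeff j f := by
      intro j
      rw [← MvPowerSeries.restrict_eq_zero_iff, ← coeff_map, (RingHom.mem_ker).1 hf, map_zero]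
    choose g hg using hdvd
    have hfg : f = C (MvPowerSeries.X i) * PowerSeries.mk g := by
      ext1 j
      rw [coeff_C_mul, coeff_mk, hg]
    rw [hfg]
    exact Ideal.mul_mem_right _ _ hi
  have hmem : ∀ f, π f ∈ (S.modelIdeal Q.asIdeal).map π ↔ f ∈ S.modelIdeal Q.asIdeal := by
    intro f
    rw [← Ideal.mem_comap, Ideal.comap_map_of_surjective' π hπ, sup_eq_left.2 hker]
  have hprime := Ideal.map_isPrime_of_surjective hπ hker
  have hmonic : π (monicPoly (p ^ S.e) S.coeff) =
      X ^ p ^ S.e + C (MvPowerSeries.restrict i (S.coeff (p ^ S.e))) := by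
    ext1 n
    rw [coeff_map, coeff_monicPoly, map_add, coeff_X_pow, coeff_C]
    split_ifs with h1 h2 h3 h4
    · lia
    · simp
    · simp [h4]
    · rw [MvPowerSeries.restrict_eq_zero_iff.2 (hS.X_dvd_coeff_of_lt hexp (by lia) (by lia)),
        add_zero]
    · lia
    · simp
  obtain ⟨s, hs, hsf⟩ := S.exists_mul_mem_pow hQ (S.h_eq p ▸ hS.h_mem)
  refine coeff_eq_zero_of_hasse_eq_zero p S.e (fun n hn hnq => ?_) hm
  refine hasse_eq_zero_of_mul_mem_pow hprime ?_ (s := π s) ?_ ?_ hn hnq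
  · rw [← MvPowerSeries.restrict_X i, ← map_C, hmem]
    exact hi'
  · rwa [hmem]
  · rw [← hmonic, ← map_mul, ← Ideal.map_pow]
    exact Ideal.mem_map_of_mem π hsf

/-- Otherwise `a_(p^e)` has order `0` along the divisor, below the positive `μ`, and its initial
form, the restriction to the divisor, is a `p^e`-th power, contradicting well-adaptedness. -/
theorem X_dvd_coeff [IsAlgClosed k] [ExpChar k p] (hS : S.IsSituation p R E)
    (had : S.WellAdapted p (atDiv i)) (hQ : Q ∈ R.support) (hi : S.par i ∈ Q.asIdeal)
    (hi' : S.par (1 - i) ∉ Q.asIdeal) (hexp : S.expo i ≠ 0) :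
    MvPowerSeries.X i ∣ S.coeff (p ^ S.e) := by
  by_contra hndvd
  have hord : (S.coeff (p ^ S.e)).weightedOrder (atDiv i) = 0 := by
    by_contra hne
    have h1 : ((1 : ℕ) : ℕ∞) ≤ (S.coeff (p ^ S.e)).weightedOrder (Pi.single i 1) :=
      Order.one_le_iff_ne_zero.2 hne
    rw [MvPowerSeries.natCast_le_weightedOrder_single_iff, pow_one] at h1
    exact hndvd h1
  rcases had with h | ⟨-, -, h⟩
  · have hle : S.mu (atDiv i) ≤ S.lastOrd p (atDiv i) := min_eq_right_iff.1 h
    rw [lastOrd, hord, ENat.toENNReal_zero, ENNReal.zero_div, S.mu_atDiv, nonpos_iff_eq_zero,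
      ENNReal.div_eq_zero_iff] at hle
    rcases hle with h0 | h0
    · exact hexp (by exact_mod_cast h0)
    · exact ENNReal.natCast_ne_top _ h0
  · refine h (MvPowerSeries.exists_pow_eq_of_coeff_eq_zero p S.e fun m j hmj => ?_)
    rw [initialForm, hord, MvPowerSeries.coeff_weightedHomogeneousComponent, atDiv,
      MvPowerSeries.weight_single_one]
    split_ifs with hmi
    · have hm := Finsupp.eq_single_one_sub (i := i) (m := m) (by simpa using hmi)
      rw [hm, ← MvPowerSeries.coeff_restrict]
      refine hS.coeff_restrict_eq_zero hQ hi hi' hexp fun hdvd => hmj ?_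
      rw [hm, Finsupp.single_apply]
      split_ifs
      · exact hdvd
      · exact dvd_zero _
    · rfl

/-- A point of the support on `{x = 0}`, other than the closed point, lies on `{z = 0}`, and forces
the slope along `{x = 0}` to be at least one. -/
theorem z_mem_and_one_le_slope [IsAlgClosed k] [ExpChar k p] (hS : S.IsSituation p R E)
    (had : S.WellAdapted p (atDiv i)) (hQ : Q ∈ R.support) (hi : S.par i ∈ Q.asIdeal)
    (hQP : Q ≠ IsLocalRing.closedPoint A) :
    S.z ∈ Q.asIdeal ∧ 1 ≤ S.slope p (atDiv i) := by
  have hi' := hS.par_one_sub_notMem hQ hi hQP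
  have hexp : S.expo i ≠ 0 := by
    obtain ⟨j, hj, hjQ⟩ := hS.exists_par_mem hQ
    have hji : j ≠ 1 - i := fun h => hi' (h ▸ hjQ)
    have hfin : ∀ i j : Fin 2, j ≠ 1 - i → j = i := by decide
    exact hfin i j hji ▸ hj
  have hz : S.z ∈ Q.asIdeal := by
    refine X_mem_of_monicPoly_mem (S.isPrime_modelIdeal Q.asIdeal) (fun j hj => ?_)
      (hS.monicPoly_mem hQ)
    have hdvd : MvPowerSeries.X i ∣ S.coeff j := by
      obtain ⟨hj1, hjq⟩ := mem_Icc.1 hj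
      rcases hjq.eq_or_lt with rfl | hlt
      · exact hS.X_dvd_coeff had hQ hi hi' hexp
      · exact hS.X_dvd_coeff_of_lt hexp hj1 hlt
    exact Ideal.mem_of_dvd _ (map_dvd (C (R := Base k)) hdvd) hi
  refine ⟨hz, ?_⟩
  have hQi := S.modelIdeal_eq_adicIdeal hz hi hi'
  refine le_min ?_ ?_
  · rw [S.one_le_lastOrd_iff (expChar_pos k p)]
    -- The coefficient of `z^0` in `h` is `a_(p^e)`, so order `p^e` along the curve is read off
    -- there.
    have h := S.mem_adicIdeal_of_mem_support hQ hQi (S.h_eq p ▸ hS.h_mem) 0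
    have hq : 0 < p ^ S.e := expChar_pow_pos k p S.e
    rwa [coeff_monicPoly, if_neg hq.ne, if_pos hq] at h
  · rw [S.one_le_mu_iff hS.lev_pos]
    have h := S.mem_adicIdeal_of_mem_support hQ hQi (S.prod_par_pow_eq S.expo ▸ hS.monomial_mem) 0
    rw [Nat.sub_zero, coeff_zero_C] at h
    have hprod : (∏ j, MvPowerSeries.X j ^ S.expo j : Base k) =
        MvPowerSeries.X (1 - i) ^ S.expo (1 - i) * MvPowerSeries.X i ^ S.expo i := by
      rw [Fin.prod_univ_two]
      fin_cases i
      · exact mul_comm _ _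
      · rfl
    have hX := MvPowerSeries.prime_X (k := k) i
    rw [hprod] at h
    have : IsDomain (Base k) := NoZeroDivisors.to_isDomain _
    have h' := hX.pow_dvd_of_dvd_mul_left _
      (fun hd => MvPowerSeries.not_X_dvd_X i (hX.dvd_of_dvd_pow hd)) h
    exact (pow_dvd_pow_iff hX.ne_zero hX.not_isUnit).1 h'

theorem eq_closedPoint_or_mem_zeroLocus [IsAlgClosed k] [ExpChar k p] (hS : S.IsSituation p R E)
    (had : ∀ i, S.WellAdapted p (atDiv i)) (hQ : Q ∈ R.support) :
    Q = IsLocalRing.closedPoint A ∨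
      ∃ i, 1 ≤ S.slope p (atDiv i) ∧ Q ∈ PrimeSpectrum.zeroLocus {S.z, S.par i} := by
  by_cases hQP : Q = IsLocalRing.closedPoint A
  · exact .inl hQP
  · obtain ⟨i, -, hi⟩ := hS.exists_par_mem hQ
    obtain ⟨hz, hslope⟩ := hS.z_mem_and_one_le_slope (had i) hQ hi hQP
    refine .inr ⟨i, hslope, ?_⟩
    simp [PrimeSpectrum.mem_zeroLocus, Set.insert_subset_iff, hz, hi]

theorem zeroLocus_subset_support [ExpChar k p] (hS : S.IsSituation p R E)
    (hP : IsLocalRing.closedPoint A ∈ R.support) (h : 1 ≤ S.slope p (atDiv i)) :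
    PrimeSpectrum.zeroLocus {S.z, S.par i} ⊆ R.support := by
  intro Q hQ
  rw [PrimeSpectrum.mem_zeroLocus, Set.insert_subset_iff, Set.singleton_subset_iff] at hQ
  by_cases hi' : S.par (1 - i) ∈ Q.asIdeal
  · rwa [S.eq_closedPoint_of_mem hQ.1 hQ.2 hi']
  · obtain ⟨Q', hQ', hQ'i⟩ := hS.exists_mem_support_of_one_le_slope h
    have : Q = Q' := PrimeSpectrum.ext (S.modelIdeal_injective
      ((S.modelIdeal_eq_adicIdeal hQ.1 hQ.2 hi').trans hQ'i.symm))
    rwa [this]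

/-- Whether the slope along a divisor is at least one is determined by the support. -/
theorem one_le_slope_iff [IsAlgClosed k] [ExpChar k p] (hS : S.IsSituation p R E)
    (had : S.WellAdapted p (atDiv i)) :
    1 ≤ S.slope p (atDiv i) ↔
      ∃ Q ∈ R.support, S.divisor i ≤ Q.asIdeal ∧ Q ≠ IsLocalRing.closedPoint A := by
  constructor
  · intro h
    obtain ⟨Q, hQ, hQi⟩ := hS.exists_mem_support_of_one_le_slope h
    have hi : S.par i ∈ Q.asIdeal := by
      rw [← C_X_mem_modelIdeal, hQi]
      exact C_mem_adicIdeal_one _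
    refine ⟨Q, hQ, (Ideal.span_singleton_le_iff_mem _).2 hi, fun hQP => ?_⟩
    have hi' : S.par (1 - i) ∈ Q.asIdeal := hQP ▸ S.par_mem_maximalIdeal (1 - i)
    rw [← C_X_mem_modelIdeal, hQi, mem_adicIdeal_one, constantCoeff_C] at hi'
    exact MvPowerSeries.not_X_dvd_X i hi'
  · rintro ⟨Q, hQ, hi, hQP⟩
    exact (hS.z_mem_and_one_le_slope had hQ ((Ideal.span_singleton_le_iff_mem _).1 hi) hQP).2

/-- The criterion of `one_le_slope_iff` involves only the support and the ideal of the divisor, so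
all presentations well-adapted there agree on it. Equality of the slopes themselves is not needed.
-/
theorem one_le_invariantH_iff [IsAlgClosed k] [ExpChar k p] (hS : S.IsSituation p R E)
    (had : S.WellAdapted p (atDiv i)) {v : ℝ≥0∞} (hv : IsInvariantH k p R E (S.divisor i) v) :
    1 ≤ v ↔ 1 ≤ S.slope p (atDiv i) := by
  obtain ⟨S', i', hS', hdiv, had', rfl⟩ := hv
  rw [hS'.one_le_slope_iff had', hS.one_le_slope_iff had, hdiv]

end MonomialData.IsSituation

end

/-! ### The four cases. -/

theorem proposition6 {k A : Type*} [Field k] [IsAlgClosed k] (p : ℕ) [ExpChar k p]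
    [CommRing A] [IsLocalRing A] [Algebra k A]
    (R : IdealisticFiltration A) (E : Set (Ideal A))
    (hP : IsLocalRing.closedPoint A ∈ R.support)
    (S : MonomialData k A) (hS : S.IsSituation p R E)
    (hadP : S.WellAdapted p MonomialData.atP)
    (hadx : S.WellAdapted p (MonomialData.atDiv 0))
    (hady : S.WellAdapted p (MonomialData.atDiv 1))
    (h_x h_y : ℝ≥0∞)
    (hx : IsInvariantH k p R E (S.divisor 0) h_x)
    (hy : IsInvariantH k p R E (S.divisor 1) h_y) :
    (1 ≤ h_x → 1 ≤ h_y → R.support =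
      PrimeSpectrum.zeroLocus {S.z, S.par 0} ∪ PrimeSpectrum.zeroLocus {S.z, S.par 1}) ∧
    (1 ≤ h_x → h_y < 1 → R.support = PrimeSpectrum.zeroLocus {S.z, S.par 0}) ∧
    (h_x < 1 → 1 ≤ h_y → R.support = PrimeSpectrum.zeroLocus {S.z, S.par 1}) ∧
    (h_x < 1 → h_y < 1 →
      R.support = PrimeSpectrum.zeroLocus {S.z, S.par 0, S.par 1} ∧
      R.support = {IsLocalRing.closedPoint A}) := by
  have had : ∀ i, S.WellAdapted p (MonomialData.atDiv i) := Fin.forall_fin_two.2 ⟨hadx, hady⟩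
  have hx' := hS.one_le_invariantH_iff hadx hx
  have hy' := hS.one_le_invariantH_iff hady hy
  have hsub := fun Q (hQ : Q ∈ R.support) => hS.eq_closedPoint_or_mem_zeroLocus had hQ
  have hsup : ∀ i, 1 ≤ S.slope p (MonomialData.atDiv i) →
      PrimeSpectrum.zeroLocus {S.z, S.par i} ⊆ R.support :=
    fun i hi => hS.zeroLocus_subset_support hP hi
  have hPz : S.z ∈ (IsLocalRing.closedPoint A).asIdeal := S.z_mem_maximalIdeal
  have hPpar : ∀ i, S.par i ∈ (IsLocalRing.closedPoint A).asIdeal :=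
    S.par_mem_maximalIdeal
  have hPmem : ∀ i, IsLocalRing.closedPoint A ∈ PrimeSpectrum.zeroLocus {S.z, S.par i} := by
    intro i
    simp [PrimeSpectrum.mem_zeroLocus, Set.insert_subset_iff, hPz, hPpar i]
  simp only [← not_le, hx', hy']
  refine ⟨fun h0 h1 => ?_, fun h0 h1 => ?_, fun h0 h1 => ?_, fun h0 h1 => ?_⟩
  · refine Set.Subset.antisymm (fun Q hQ => ?_) (Set.union_subset (hsup 0 h0) (hsup 1 h1))
    rcases hsub Q hQ with rfl | ⟨i, -, hi⟩
    · exact .inl (hPmem 0)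
    · fin_cases i
      · exact .inl hi
      · exact .inr hi
  · refine Set.Subset.antisymm (fun Q hQ => ?_) (hsup 0 h0)
    rcases hsub Q hQ with rfl | ⟨i, hslope, hi⟩
    · exact hPmem 0
    · fin_cases i
      · exact hi
      · exact absurd hslope h1
  · refine Set.Subset.antisymm (fun Q hQ => ?_) (hsup 1 h1)
    rcases hsub Q hQ with rfl | ⟨i, hslope, hi⟩
    · exact hPmem 1
    · fin_cases i
      · exact absurd hslope h0
      · exact hi
  · have hsupp : R.support = {IsLocalRing.closedPoint A} := by
      refine Set.Subset.antisymm (fun Q hQ => ?_) (Set.singleton_subset_iff.2 hP)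
      rcases hsub Q hQ with rfl | ⟨i, hslope, -⟩
      · rfl
      · fin_cases i
        · exact absurd hslope h0
        · exact absurd hslope h1
    refine ⟨hsupp.trans (Set.Subset.antisymm ?_ fun Q hQ => ?_), hsupp⟩
    · rw [Set.singleton_subset_iff]
      simp [PrimeSpectrum.mem_zeroLocus, Set.insert_subset_iff, hPz, hPpar]
    · rw [PrimeSpectrum.mem_zeroLocus, Set.insert_subset_iff, Set.insert_subset_iff,
        Set.singleton_subset_iff] at hQ
      exact S.eq_closedPoint_of_mem (i := 0) hQ.1 hQ.2.1 hQ.2.2
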